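/- Consider a fully connected gossip network with $n\ge 1$ nodes and a two-state source $Q(t)\in\{1,2\}$ that jumps $1\to2$ at rate $q_{12}>0$ and $2\to1$ at rate $q_{21}>0$; put $\pi_1=\frac{q_{21}}{q_{12}+q_{21}}$, $\pi_2=\frac{q_{12}}{q_{12}+q_{21}}$. Node $\ell$ has a version age $X_\ell(t)\in\{0,1,2,\dots\}$ and an accuracy bit $C_\ell(t)\in\{0,1\}$. Each source jump replaces every $X_\ell$ by $X_\ell+1$ and every $C_\ell$ by $1-C_\ell$. At rate $\lambda_s/n$ ($\lambda_s>0$) the source pushes to node $j$, which sets $X_j=0$, $C_j=1$. For each ordered pair $i\ne j$, at rate $\lambda/(n-1)$ ($\lambda\ge0$; there are no such pairs if $n=1$), node $i$ sends its packet to node $j$: if $X_i\le X_j$ then $(X_j,C_j)$ is replaced by $(X_i,C_i)$, and otherwise nothing changes. All these events are independent, so $(Q,C,X)$ is a continuous-time Markov chain. For a nonempty set $A$ of nodes let $F_A(t)=C_{\ell^*}(t)$, where $\ell^*\in A$ is a node of $A$ with minimal version age. For $1\le k\le n$ put $\alpha_k=\frac{k\lambda_s}{n}$, and for $1\le k\le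 n-1$ put $\beta_k=\frac{k(n-k)\lambda}{n-1}$, $V_k=\beta_kI_2$, $$W_k=\begin{pmatrix} q_{12}+\alpha_k+\beta_k & q_{21}\\ q_{12} & q_{21}+\alpha_k+\beta_k\end{pmatrix},\qquad \mathbf v_k=\begin{pmatrix} q_{21}\pi_2+\alpha_k\pi_1\\ q_{12}\pi_1+\alpha_k\pi_2\end{pmatrix}.$$ Then for every $k\in\{1,\dots,n\}$ and $m\in\{1,2\}$ the limit $$f_k^{(m)}=\lim_{t\to\infty}\mathbb E\big[F_A(t)\,\mathbf 1_{\{Q(t)=m\}}\big]$$ exists and is the same for every set $A$ of $k$ nodes and every initial law of $(Q,C,X)$. The vectors $\mathbf f_k=(f_k^{(1)},f_k^{(2)})^T$ satisfy $$W_k\mathbf f_k=\mathbf v_k+V_k\mathbf f_{k+1},\qquad k=1,\dots,n-1,$$ where each $W_k$ is invertible, so that $\mathbf f_k=W_k^{-1}(\mathbf v_k+V_k\mathbf f_{k+1})$. Moreover $$q_{21}(\pi_2-f_n^{(2)})-q_{12}f_n^{(1)}+\lambda_s(\pi_1-f_n^{(1)})=0,\qquad q_{12}(\pi_1-f_n^{(1)})-q_{21}f_n^{(2)}+\lambda_s(\pi_2-f_n^{(2)})=0,$$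 and $$\mathbf f_n=\frac{1}{(q_{12}+q_{21})(\lambda_s+q_{12}+q_{21})}\begin{pmatrix} q_{21}(\lambda_s+q_{21})\\ q_{12}(\lambda_s+q_{12})\end{pmatrix}.$$ -/

import Mathlib

open Filter Topology MeasureTheory

namespace GossipNet

/-- Rates of the network: `q12`, `q21` are the transition rates of the binary source, `lamS` is the
total source push rate and `lam` the gossip rate of each node. -/
structure Rates where
  q12 : ℝ
  q21 : ℝ
  lamS : ℝ
  lam : ℝ
  q12_pos : 0 < q12
  q21_pos : 0 < q21
  lamS_pos : 0 < lamS
  lam_nonneg : 0 ≤ lam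

/-- Hybrid state of the network: the source mode `Q` (the value `0` stands for source state 1,
the value `1` for source state 2), the accuracy bits `C` and the version ages `X` of the nodes. -/
@[ext]
structure State (n : ℕ) where
  Q : Fin 2
  C : Fin n → Bool
  X : Fin n → ℕ

instance (n : ℕ) : MeasurableSpace (State n) := ⊤

/-- The transitions: the two source flips, a source push to node `j`, and a gossip packet sent
from node `p.1` to a different node `p.2`. -/
inductive Event (n : ℕ) where
  | flip12
  | flip21
  | push (j : Fin n)
  | gossip (p : {p : Fin n × Fin n // p.1 ≠ p.2})
  deriving Fintype

/-- The rate of each transition when the source is in mode `q`. -/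
noncomputable def rate (P : Rates) {n : ℕ} : Event n → Fin 2 → ℝ
  | .flip12, q => if q = 0 then P.q12 else 0
  | .flip21, q => if q = 1 then P.q21 else 0
  | .push _, _ => P.lamS / n
  | .gossip _, _ => P.lam / ((n : ℝ) - 1)

/-- The reset map of each transition. -/
def reset {n : ℕ} : Event n → State n → State n
  | .flip12, s => ⟨1, fun l => !(s.C l), fun l => s.X l + 1⟩
  | .flip21, s => ⟨0, fun l => !(s.C l), fun l => s.X l + 1⟩
  | .push j, s => ⟨s.Q, Function.update s.C j true, Function.update s.X j 0⟩
  | .gossip p, s =>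
      ⟨s.Q,
        Function.update s.C p.1.2 (if s.X p.1.1 ≤ s.X p.1.2 then s.C p.1.1 else s.C p.1.2),
        Function.update s.X p.1.2 (min (s.X p.1.1) (s.X p.1.2))⟩

theorem rate_nonneg (P : Rates) {n : ℕ} (e : Event n) (q : Fin 2) : 0 ≤ rate P e q := by
  have h1 := P.q12_pos.le
  have h2 := P.q21_pos.le
  have h3 := P.lamS_pos.le
  have h4 := P.lam_nonneg
  cases e with
  | flip12 => simp only [rate]; split_ifs <;> simp [h1]
  | flip21 => simp only [rate]; split_ifs <;> simp [h2]
  | push j => simp only [rate]; positivity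
  | gossip p =>
    have hn : (1 : ℝ) ≤ n := by exact_mod_cast (Fin.pos p.1.1)
    simp only [rate]
    exact div_nonneg h4 (by linarith)

/-- A bound on the total transition rate out of any state, used as the rate of the Poisson clock
that drives the chain. -/
noncomputable def clockRate (P : Rates) (n : ℕ) : ℝ := ∑ e : Event n, ∑ q : Fin 2, rate P e q

theorem clockRate_pos (P : Rates) (n : ℕ) : 0 < clockRate P n := by
  refine Finset.sum_pos' (fun e _ => Finset.sum_nonneg fun q _ => rate_nonneg P e q)
    ⟨Event.flip12, Finset.mem_univ _, ?_⟩
  simpa [rate, Fin.sum_univ_two] using P.q12_pos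

theorem sum_rate_le_clockRate (P : Rates) (n : ℕ) (q : Fin 2) :
    ∑ e : Event n, rate P e q ≤ clockRate P n :=
  Finset.sum_le_sum fun e _ =>
    Finset.single_le_sum (f := fun q => rate P e q) (fun q' _ => rate_nonneg P e q')
      (Finset.mem_univ q)

/-- What happens at a tick of the clock when the source is in mode `q`: transition `e` with
probability `rate e q / clockRate`, and nothing (`none`) with the remaining probability. -/
noncomputable def tick (P : Rates) (n : ℕ) (q : Fin 2) : PMF (Option (Event n)) :=
  PMF.ofFintype
    (fun o => o.elim (ENNReal.ofReal (1 - ∑ e : Event n, rate P e q / clockRate P n))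
      (fun e => ENNReal.ofReal (rate P e q / clockRate P n)))
    (by
      have hΛ := clockRate_pos P n
      have h0 : ∀ e : Event n, 0 ≤ rate P e q / clockRate P n := fun e =>
        div_nonneg (rate_nonneg P e q) hΛ.le
      have h1 : ∑ e : Event n, rate P e q / clockRate P n ≤ 1 := by
        rw [← Finset.sum_div]
        exact (div_le_one hΛ).2 (sum_rate_le_clockRate P n q)
      rw [Fintype.sum_option]
      simp only [Option.elim]
      rw [← ENNReal.ofReal_sum_of_nonneg (fun e _ => h0 e),
        ← ENNReal.ofReal_add (by linarith) (Finset.sum_nonneg fun e _ => h0 e)]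
      simp)

/-- One step of the jump chain: the transition drawn at a tick resets the state. -/
noncomputable def step (P : Rates) {n : ℕ} (s : State n) : PMF (State n) :=
  (tick P n s.Q).map (fun o => o.elim s (fun e => reset e s))

/-- Law of the state after `k` ticks of the clock, with initial law `μ₀`. -/
noncomputable def jumpChain (P : Rates) {n : ℕ} (μ₀ : PMF (State n)) : ℕ → PMF (State n)
  | 0 => μ₀
  | k + 1 => (jumpChain P μ₀ k).bind (step P)

/-- Law at time `t ≥ 0` of the continuous-time Markov chain with initial law `μ₀` in which each
transition `e` occurs at rate `rate e Q` and acts by `reset e`: the number of ticks up to time `t`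
is Poisson with mean `clockRate * t`. Since `clockRate` bounds the total rate out of every state,
this is `μ₀ exp (t L)` for the generator
`L ψ s = ∑ e, rate e s.Q * (ψ (reset e s) - ψ s)`. -/
noncomputable def law (P : Rates) {n : ℕ} (μ₀ : PMF (State n)) (t : ℝ) : PMF (State n) :=
  (ProbabilityTheory.poissonMeasure (clockRate P n * t).toNNReal).toPMF.bind (jumpChain P μ₀)

/-- Accuracy (`1` or `0`) of a freshest node of the nonempty set `A`, that is, of a node of `A`
with minimal version age. -/
noncomputable def freshAcc {n : ℕ} (A : Finset (Fin n)) (hA : A.Nonempty) (s : State n) : ℝ :=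
  if s.C (Function.argminOn s.X (A : Set (Fin n)) (Finset.coe_nonempty.2 hA)) = true then 1 else 0

/-- The expectation at time `t` of the accuracy of the freshest node of `A` times the indicator
that the source is in mode `m`. -/
noncomputable def taggedAcc (P : Rates) {n : ℕ} (μ₀ : PMF (State n)) (A : Finset (Fin n))
    (hA : A.Nonempty) (m : Fin 2) (t : ℝ) : ℝ :=
  ∫ s, freshAcc A hA s * (if s.Q = m then 1 else 0) ∂(law P μ₀ t).toMeasure

/-- The stationary distribution of the binary source. -/
noncomputable def srcStat (P : Rates) : Fin 2 → ℝ :=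
  ![P.q21 / (P.q12 + P.q21), P.q12 / (P.q12 + P.q21)]

/-- Total source push rate into a set of `k` nodes. -/
noncomputable def pushRate (P : Rates) (n k : ℕ) : ℝ := k * P.lamS / n

/-- Total rate of gossip from outside into a set of `k` nodes. -/
noncomputable def gossipRate (P : Rates) (n k : ℕ) : ℝ :=
  k * ((n : ℝ) - k) * P.lam / ((n : ℝ) - 1)

noncomputable def W (P : Rates) (n k : ℕ) : Matrix (Fin 2) (Fin 2) ℝ :=
  !![P.q12 + pushRate P n k + gossipRate P n k, P.q21;
     P.q12, P.q21 + pushRate P n k + gossipRate P n k]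

noncomputable def V (P : Rates) (n k : ℕ) : Matrix (Fin 2) (Fin 2) ℝ :=
  gossipRate P n k • (1 : Matrix (Fin 2) (Fin 2) ℝ)

noncomputable def v (P : Rates) (n k : ℕ) : Fin 2 → ℝ :=
  ![P.q21 * srcStat P 1 + pushRate P n k * srcStat P 0,
    P.q12 * srcStat P 0 + pushRate P n k * srcStat P 1]

end GossipNet

/-!
The law at time `t` is a Poisson mixture of the laws of the jump chain, so it suffices to find limits
along the ticks of the clock (`tendsto_integral_law`), where the generator (`drift`) gives exact
one-step recursions (`mean_succ`).

A packet pushed by the source starts with age `0` and accurate, and every source flip changes both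
the parity of its age and its accuracy. Hence a node is accurate exactly when its age is even, unless
it still holds a packet of the initial state. Let `b` be the number of nodes that violate this rule
(`badSet`). For small `ε`, `1 - ε ^ b` is a Lyapunov function (`drift_badness_le`), so violations
disappear in the limit (`tendsto_mean_bad`), and the accuracy of a freshest node of `A` may be
replaced by the parity of the minimal age in `A`, whatever the choice among ties.

For this parity (`tag`) the recursion holds in every state (`drift_tag`): flips exchange the
parities, pushes into `A` reset the minimal age to `0`, and gossip from `i ∉ A` into `A` turns the
minimal age of `A` into that of `insert i A`. The moments of `A` thus obey a linear recursion with
matrix `1 - W / clockRate`, driven by the moments of sets with one more node. The left eigenvectors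
`(1, -1)` and `(q12, q21)` of `W` decouple it into two scalar contractions
(`tendsto_zero_of_pair_recursion`), and a downward induction on the size of `A` gives the limits and
their equations at once (`tendsto_mean_tag`).
-/

namespace GossipNet

open scoped ProbabilityTheory

/-! ### Integrals against discrete laws -/

section Discrete

variable {α β : Type*} [MeasurableSpace α] [DiscreteMeasurableSpace α]
  [MeasurableSpace β] [DiscreteMeasurableSpace β]

theorem integrable_toMeasure_of_abs_le (p : PMF α) {ψ : α → ℝ} {M : ℝ} (h : ∀ a, |ψ a| ≤ M) :
    Integrable ψ p.toMeasure :=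
  Integrable.of_bound (Measurable.of_discrete).aestronglyMeasurable M
    (ae_of_all _ h)

theorem integral_toMeasure_bind [Countable α] (p : PMF α) (f : α → PMF β) {ψ : β → ℝ} {M : ℝ}
    (h : ∀ b, |ψ b| ≤ M) :
    ∫ b, ψ b ∂(p.bind f).toMeasure = ∫ a, ∫ b, ψ b ∂(f a).toMeasure ∂p.toMeasure := by
  let κ : ProbabilityTheory.Kernel α β := ⟨fun a => (f a).toMeasure, Measurable.of_discrete⟩
  have hκ : (p.bind f).toMeasure = p.toMeasure.bind κ := by
    ext s hs
    rw [PMF.toMeasure_bind_apply _ _ _ hs, Measure.bind_apply hs κ.aemeasurable,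
      lintegral_countable']
    refine tsum_congr fun a => ?_
    rw [PMF.toMeasure_apply_singleton _ _ (measurableSet_singleton a), mul_comm]
    rfl
  have hc : (p.bind f).toMeasure = (κ ∘ₖ ProbabilityTheory.Kernel.const Unit p.toMeasure) () := by
    rw [ProbabilityTheory.Kernel.comp_apply, ProbabilityTheory.Kernel.const_apply, hκ]
  rw [hc, ProbabilityTheory.Kernel.integral_comp, ProbabilityTheory.Kernel.const_apply]
  · rfl
  · rw [← hc]
    exact integrable_toMeasure_of_abs_le _ h

end Discrete

/-! ### Linear recursions and Poisson averages -/

theorem tendsto_zero_of_le_mul_add {x d : ℕ → ℝ} {a : ℝ} (ha0 : 0 ≤ a) (ha1 : a < 1)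
    (hx : ∀ k, 0 ≤ x k) (hd : Tendsto d atTop (𝓝 0)) (h : ∀ k, x (k + 1) ≤ a * x k + d k) :
    Tendsto x atTop (𝓝 0) := by
  refine Metric.tendsto_atTop.2 fun ε hε => ?_
  obtain ⟨K, hK⟩ := Metric.tendsto_atTop.1 hd ((1 - a) * (ε / 2))
    (mul_pos (by linarith) (by linarith))
  have key : ∀ j, x (K + j) ≤ a ^ j * x K + ε / 2 := by
    intro j
    induction j with
    | zero => simp; linarith
    | succ j ih =>
      have h1 := h (K + j)
      have h2 := hK (K + j) (by omega)
      rw [Real.dist_eq, sub_zero] at h2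
      have h3 := le_abs_self (d (K + j))
      have h4 := mul_le_mul_of_nonneg_left ih ha0
      rw [← add_assoc, pow_succ]
      nlinarith
  have hpow : Tendsto (fun j : ℕ => a ^ j * x K) atTop (𝓝 0) := by
    simpa using (tendsto_pow_atTop_nhds_zero_of_lt_one ha0 ha1).mul_const (x K)
  obtain ⟨J, hJ⟩ := Metric.tendsto_atTop.1 hpow (ε / 2) (by linarith)
  refine ⟨K + J, fun k hk => ?_⟩
  obtain ⟨j, rfl⟩ := Nat.exists_eq_add_of_le (show K ≤ k by omega)
  have h1 := hJ j (by omega)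
  rw [Real.dist_eq, sub_zero] at h1 ⊢
  rw [abs_of_nonneg (hx _)]
  have := le_abs_self (a ^ j * x K)
  linarith [key j]

theorem tendsto_zero_of_eq_mul_add {x d : ℕ → ℝ} {a : ℝ} (ha0 : 0 ≤ a) (ha1 : a < 1)
    (hd : Tendsto d atTop (𝓝 0)) (h : ∀ k, x (k + 1) = a * x k + d k) :
    Tendsto x atTop (𝓝 0) := by
  rw [tendsto_zero_iff_abs_tendsto_zero]
  refine tendsto_zero_of_le_mul_add ha0 ha1 (fun _ => abs_nonneg _)
    ((tendsto_zero_iff_abs_tendsto_zero _).1 hd) fun k => ?_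
  simp only [Function.comp_apply]
  rw [h k]
  refine (abs_add_le _ _).trans ?_
  rw [abs_mul, abs_of_nonneg ha0]

/-- A perturbed Euler scheme with step `1 / Λ` for the matrix of `W`. The coordinates
`x₀ - x₁` and `a x₀ + b x₁` are left eigenvectors of that matrix, with eigenvalues `γ` and
`a + b + γ`, and decouple the two recursions. -/
theorem tendsto_zero_of_pair_recursion {x y d e : ℕ → ℝ} {a b γ Λ : ℝ} (ha : 0 < a) (hb : 0 < b)
    (hγ : 0 < γ) (hΛ : a + b + γ ≤ Λ) (hd : Tendsto d atTop (𝓝 0)) (he : Tendsto e atTop (𝓝 0))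
    (hx : ∀ k, x (k + 1) = x k + (-(a + γ) * x k - b * y k + d k) / Λ)
    (hy : ∀ k, y (k + 1) = y k + (-(b + γ) * y k - a * x k + e k) / Λ) :
    Tendsto x atTop (𝓝 0) ∧ Tendsto y atTop (𝓝 0) := by
  have hΛ0 : 0 < Λ := by linarith
  have hu : Tendsto (fun k => x k - y k) atTop (𝓝 0) := by
    refine tendsto_zero_of_eq_mul_add (a := 1 - γ / Λ) (d := fun k => (d k - e k) / Λ)
      (sub_nonneg.2 ((div_le_one hΛ0).2 (by linarith))) (by linarith [div_pos hγ hΛ0])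
      (by simpa using (hd.sub he).div_const Λ) fun k => ?_
    rw [hx, hy]
    field_simp
    ring
  have hw : Tendsto (fun k => a * x k + b * y k) atTop (𝓝 0) := by
    refine tendsto_zero_of_eq_mul_add (a := 1 - (a + b + γ) / Λ)
      (d := fun k => (a * d k + b * e k) / Λ)
      (sub_nonneg.2 ((div_le_one hΛ0).2 hΛ))
      (by linarith [div_pos (show 0 < a + b + γ by linarith) hΛ0])
      (by simpa using ((hd.const_mul a).add (he.const_mul b)).div_const Λ) fun k => ?_
    rw [hx, hy]
    field_simp
    ring
  have hab : a + b ≠ 0 := by positivity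
  constructor
  · have := (hw.add (hu.const_mul b)).div_const (a + b)
    simp only [mul_zero, add_zero, zero_div] at this
    refine this.congr fun k => ?_
    field_simp
    ring
  · have := (hw.sub (hu.const_mul a)).div_const (a + b)
    simp only [mul_zero, sub_zero, zero_div] at this
    refine this.congr fun k => ?_
    field_simp
    ring

theorem tendsto_poissonMeasure_real_singleton (j : ℕ) :
    Tendsto (fun r : NNReal => (ProbabilityTheory.poissonMeasure r).real {j}) atTop (𝓝 0) := by
  simp only [ProbabilityTheory.poissonMeasure_real_singleton]
  have h := (Real.tendsto_pow_mul_exp_neg_atTop_nhds_zero j).div_const (j.factorial : ℝ)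
  rw [zero_div] at h
  refine (h.comp (NNReal.tendsto_coe_atTop.2 tendsto_id)).congr fun r => ?_
  simp [mul_comm]

/-- Averages of a convergent sequence over a Poisson index converge to the same limit as the
Poisson mean tends to infinity, since the mass escapes from every finite set. -/
theorem tendsto_integral_poissonMeasure {a : ℕ → ℝ} {l : ℝ} (ha : Tendsto a atTop (𝓝 l)) :
    Tendsto (fun r : NNReal => ∫ k, a k ∂ProbabilityTheory.poissonMeasure r) atTop (𝓝 l) := by
  obtain ⟨M, hM⟩ : ∃ M, ∀ k, |a k - l| ≤ M := by
    obtain ⟨M, hM⟩ := (Metric.isBounded_range_of_tendsto _ (ha.sub_const l)).exists_norm_le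
    exact ⟨M, fun k => hM _ ⟨k, rfl⟩⟩
  have hM0 : 0 ≤ M := (abs_nonneg _).trans (hM 0)
  refine Metric.tendsto_atTop.2 fun ε hε => ?_
  obtain ⟨K, hK⟩ := Metric.tendsto_atTop.1 ha (ε / 2) (by linarith)
  have hsum : Tendsto (fun r : NNReal => ∑ j ∈ Finset.range K,
      M * (ProbabilityTheory.poissonMeasure r).real {j}) atTop (𝓝 0) := by
    simpa using tendsto_finsetSum (Finset.range K) fun j _ =>
      (tendsto_poissonMeasure_real_singleton j).const_mul M
  obtain ⟨R, hR⟩ := Metric.tendsto_atTop.1 hsum (ε / 2) (by linarith)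
  refine ⟨R, fun r hr => ?_⟩
  have hr' := hR r hr
  rw [Real.dist_eq, sub_zero] at hr'
  have hint : Integrable (fun k => a k - l) (ProbabilityTheory.poissonMeasure r) :=
    Integrable.of_bound (Measurable.of_discrete).aestronglyMeasurable M
      (ae_of_all _ fun k => by simpa using hM k)
  have hia : Integrable a (ProbabilityTheory.poissonMeasure r) := by
    exact (hint.add (integrable_const l)).congr (ae_of_all _ fun k => sub_add_cancel (a k) l)
  have hind : ∀ j ∈ Finset.range K, Integrable (fun k => ({j} : Set ℕ).indicator (fun _ => M) k)
      (ProbabilityTheory.poissonMeasure r) := fun j _ =>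
    (integrable_const M).indicator (measurableSet_singleton j)
  rw [Real.dist_eq]
  calc |∫ k, a k ∂ProbabilityTheory.poissonMeasure r - l|
      = |∫ k, (a k - l) ∂ProbabilityTheory.poissonMeasure r| := by
        rw [integral_sub hia (integrable_const l)]; simp
    _ ≤ ∫ k, |a k - l| ∂ProbabilityTheory.poissonMeasure r := abs_integral_le_integral_abs
    _ ≤ ∫ k, (ε / 2 + ∑ j ∈ Finset.range K, ({j} : Set ℕ).indicator (fun _ => M) k)
          ∂ProbabilityTheory.poissonMeasure r := by
        refine integral_mono hint.abs ((integrable_const _).add (integrable_finsetSum _ hind))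
          fun k => ?_
        have hnn : 0 ≤ ∑ j ∈ Finset.range K, ({j} : Set ℕ).indicator (fun _ => M) k :=
          Finset.sum_nonneg fun j _ => Set.indicator_nonneg (fun _ _ => hM0) _
        by_cases hk : K ≤ k
        · have := hK k hk
          rw [Real.dist_eq] at this
          simp only
          linarith
        · have h1 : ({k} : Set ℕ).indicator (fun _ => M) k
              ≤ ∑ j ∈ Finset.range K, ({j} : Set ℕ).indicator (fun _ => M) k :=
            Finset.single_le_sum (f := fun j => ({j} : Set ℕ).indicator (fun _ => M) k)
              (fun j _ => Set.indicator_nonneg (fun _ _ => hM0) _) (Finset.mem_range.2 (by omega))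
          rw [Set.indicator_of_mem (Set.mem_singleton k)] at h1
          simp only
          linarith [hM k]
    _ = ε / 2 + ∑ j ∈ Finset.range K, M * (ProbabilityTheory.poissonMeasure r).real {j} := by
        rw [integral_add (integrable_const _) (integrable_finsetSum _ hind),
          integral_finsetSum _ hind]
        congr 1
        · simp
        · refine Finset.sum_congr rfl fun j _ => ?_
          rw [integral_indicator_const _ (measurableSet_singleton j), smul_eq_mul, mul_comm]
    _ < ε := by linarith [le_abs_self (∑ j ∈ Finset.range K,
        M * (ProbabilityTheory.poissonMeasure r).real {j})]

/-! ### The generator and the jump chain -/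

instance (n : ℕ) : DiscreteMeasurableSpace (State n) := ⟨fun _ => trivial⟩

instance (n : ℕ) : Countable (State n) :=
  Function.Injective.countable (f := fun s : State n => (s.Q, s.C, s.X)) fun s t h => by
    simp only [Prod.mk.injEq] at h
    exact State.ext h.1 h.2.1 h.2.2

theorem sum_event {n : ℕ} (g : Event n → ℝ) :
    ∑ e, g e = g .flip12 + g .flip21 + ∑ j, g (.push j) + ∑ p, g (.gossip p) := by
  let E : Event n ≃ (Unit ⊕ Unit) ⊕ (Fin n ⊕ {p : Fin n × Fin n // p.1 ≠ p.2}) :=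
    { toFun := fun e => match e with
        | .flip12 => .inl (.inl ())
        | .flip21 => .inl (.inr ())
        | .push j => .inr (.inl j)
        | .gossip p => .inr (.inr p)
      invFun := fun x => match x with
        | .inl (.inl _) => .flip12
        | .inl (.inr _) => .flip21
        | .inr (.inl j) => .push j
        | .inr (.inr p) => .gossip p
      left_inv := fun e => by cases e <;> rfl
      right_inv := fun x => by rcases x with (_ | _) | (_ | _) <;> rfl }
  rw [← E.symm.sum_comp]
  simp [E, Fintype.sum_sum_type, add_assoc]

/-- The generator of the network, applied to the observable `ψ`. -/
noncomputable def drift (P : Rates) {n : ℕ} (ψ : State n → ℝ) (s : State n) : ℝ :=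
  ∑ e, rate P e s.Q * (ψ (reset e s) - ψ s)

theorem integral_step (P : Rates) {n : ℕ} (ψ : State n → ℝ) (s : State n) :
    ∫ s', ψ s' ∂(step P s).toMeasure = ψ s + drift P ψ s / clockRate P n := by
  let _ : MeasurableSpace (Option (Event n)) := ⊤
  have : DiscreteMeasurableSpace (Option (Event n)) := ⟨fun _ => trivial⟩
  have hΛ := clockRate_pos P n
  rw [step, ← PMF.toMeasure_map _ _ Measurable.of_discrete,
    integral_map Measurable.of_discrete.aemeasurable
      Measurable.of_discrete.aestronglyMeasurable, PMF.integral_eq_sum, Fintype.sum_option]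
  have h0 : 0 ≤ 1 - ∑ e : Event n, rate P e s.Q / clockRate P n := by
    rw [← Finset.sum_div, sub_nonneg]
    exact (div_le_one hΛ).2 (sum_rate_le_clockRate P n s.Q)
  have h1 : ∀ e : Event n, (tick P n s.Q (some e)).toReal = rate P e s.Q / clockRate P n :=
    fun e => ENNReal.toReal_ofReal (div_nonneg (rate_nonneg P e s.Q) hΛ.le)
  have h2 : (tick P n s.Q none).toReal = 1 - ∑ e : Event n, rate P e s.Q / clockRate P n :=
    ENNReal.toReal_ofReal h0
  simp only [h1, h2, Option.elim, smul_eq_mul, drift]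
  rw [Finset.sum_div, sub_mul, one_mul, Finset.sum_mul, sub_add_eq_add_sub, add_sub_assoc,
    ← Finset.sum_sub_distrib]
  congr 1
  exact Finset.sum_congr rfl fun e _ => by ring

/-- Mean of the observable `ψ` after `k` ticks of the clock. -/
noncomputable def mean (P : Rates) {n : ℕ} (μ₀ : PMF (State n)) (ψ : State n → ℝ) (k : ℕ) : ℝ :=
  ∫ s, ψ s ∂(jumpChain P μ₀ k).toMeasure

theorem abs_drift_le (P : Rates) {n : ℕ} {ψ : State n → ℝ} {M : ℝ} (h : ∀ s, |ψ s| ≤ M)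
    (s : State n) : |drift P ψ s| ≤ clockRate P n * (2 * M) := by
  have hM : 0 ≤ M := (abs_nonneg _).trans (h s)
  refine (Finset.abs_sum_le_sum_abs _ _).trans ?_
  refine le_trans (Finset.sum_le_sum (g := fun e => rate P e s.Q * (2 * M)) fun e _ => ?_) ?_
  · rw [abs_mul, abs_of_nonneg (rate_nonneg P e _)]
    refine mul_le_mul_of_nonneg_left ((abs_sub _ _).trans ?_) (rate_nonneg P e _)
    linarith [h s, h (reset e s)]
  · rw [← Finset.sum_mul]
    exact mul_le_mul_of_nonneg_right (sum_rate_le_clockRate P n _) (by linarith)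

theorem mean_succ (P : Rates) {n : ℕ} (μ₀ : PMF (State n)) {ψ : State n → ℝ} {M : ℝ}
    (h : ∀ s, |ψ s| ≤ M) (k : ℕ) :
    mean P μ₀ ψ (k + 1) = mean P μ₀ ψ k + mean P μ₀ (drift P ψ) k / clockRate P n := by
  simp only [mean, jumpChain]
  rw [integral_toMeasure_bind _ _ h]
  simp only [integral_step]
  rw [integral_add (integrable_toMeasure_of_abs_le _ h)
    ((integrable_toMeasure_of_abs_le _ (abs_drift_le P h)).div_const _), integral_div]

theorem integral_law (P : Rates) {n : ℕ} (μ₀ : PMF (State n)) {ψ : State n → ℝ} {M : ℝ}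
    (h : ∀ s, |ψ s| ≤ M) (t : ℝ) :
    ∫ s, ψ s ∂(law P μ₀ t).toMeasure =
      ∫ k, mean P μ₀ ψ k ∂ProbabilityTheory.poissonMeasure (clockRate P n * t).toNNReal := by
  rw [law, integral_toMeasure_bind _ _ h, Measure.toPMF_toMeasure]
  rfl

/-- A limit along the ticks of the clock is also the limit along continuous time. -/
theorem tendsto_integral_law (P : Rates) {n : ℕ} (μ₀ : PMF (State n)) {ψ : State n → ℝ} {M l : ℝ}
    (h : ∀ s, |ψ s| ≤ M) (hl : Tendsto (mean P μ₀ ψ) atTop (𝓝 l)) :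
    Tendsto (fun t => ∫ s, ψ s ∂(law P μ₀ t).toMeasure) atTop (𝓝 l) := by
  simp only [integral_law P μ₀ h]
  exact (tendsto_integral_poissonMeasure hl).comp (tendsto_real_toNNReal_atTop.comp
    (tendsto_id.const_mul_atTop (clockRate_pos P n)))

theorem mean_mono (P : Rates) {n : ℕ} (μ₀ : PMF (State n)) {φ ψ : State n → ℝ} {M N : ℝ}
    (hφ : ∀ s, |φ s| ≤ M) (hψ : ∀ s, |ψ s| ≤ N) (h : ∀ s, φ s ≤ ψ s) (k : ℕ) :
    mean P μ₀ φ k ≤ mean P μ₀ ψ k :=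
  integral_mono (integrable_toMeasure_of_abs_le _ hφ) (integrable_toMeasure_of_abs_le _ hψ) h

theorem mean_const_mul (P : Rates) {n : ℕ} (μ₀ : PMF (State n)) (c : ℝ) (ψ : State n → ℝ)
    (k : ℕ) : mean P μ₀ (fun s => c * ψ s) k = c * mean P μ₀ ψ k :=
  integral_const_mul _ _

theorem mean_add (P : Rates) {n : ℕ} (μ₀ : PMF (State n)) {φ ψ : State n → ℝ} {M N : ℝ}
    (hφ : ∀ s, |φ s| ≤ M) (hψ : ∀ s, |ψ s| ≤ N) (k : ℕ) :
    mean P μ₀ (fun s => φ s + ψ s) k = mean P μ₀ φ k + mean P μ₀ ψ k :=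
  integral_add (integrable_toMeasure_of_abs_le _ hφ) (integrable_toMeasure_of_abs_le _ hψ)

theorem mean_sub (P : Rates) {n : ℕ} (μ₀ : PMF (State n)) {φ ψ : State n → ℝ} {M N : ℝ}
    (hφ : ∀ s, |φ s| ≤ M) (hψ : ∀ s, |ψ s| ≤ N) (k : ℕ) :
    mean P μ₀ (fun s => φ s - ψ s) k = mean P μ₀ φ k - mean P μ₀ ψ k :=
  integral_sub (integrable_toMeasure_of_abs_le _ hφ) (integrable_toMeasure_of_abs_le _ hψ)

/-! ### Decay of inherited packets -/

/-- The nodes whose accuracy bit is not the parity of their version age. Both source flips and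
packet transfers respect that parity, and a pushed packet has it, so these are nodes that still
hold a packet of the initial state. -/
def badSet {n : ℕ} (s : State n) : Finset (Fin n) :=
  Finset.univ.filter fun l => s.C l ≠ decide (Even (s.X l))

theorem mem_badSet {n : ℕ} {s : State n} {l : Fin n} :
    l ∈ badSet s ↔ s.C l ≠ decide (Even (s.X l)) := by
  simp [badSet]

theorem badSet_flip12 {n : ℕ} (s : State n) : badSet (reset .flip12 s) = badSet s := by
  ext l
  simp only [mem_badSet, reset, Nat.even_add_one]
  by_cases h : Even (s.X l) <;> cases s.C l <;> simp [h]

theorem badSet_flip21 {n : ℕ} (s : State n) : badSet (reset .flip21 s) = badSet s := by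
  ext l
  simp only [mem_badSet, reset, Nat.even_add_one]
  by_cases h : Even (s.X l) <;> cases s.C l <;> simp [h]

theorem badSet_push {n : ℕ} (j : Fin n) (s : State n) :
    badSet (reset (.push j) s) = (badSet s).erase j := by
  ext l
  simp only [mem_badSet, reset, Finset.mem_erase]
  by_cases h : l = j
  · subst h; simp
  · simp [h]

theorem mem_badSet_gossip {n : ℕ} (p : {p : Fin n × Fin n // p.1 ≠ p.2}) (s : State n)
    (l : Fin n) (hl : l ∈ badSet (reset (.gossip p) s)) :
    l ∈ badSet s ∨ l = p.1.2 ∧ p.1.1 ∈ badSet s := by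
  simp only [mem_badSet, reset] at hl ⊢
  by_cases h : l = p.1.2
  · subst h
    by_cases hx : s.X p.1.1 ≤ s.X p.1.2
    · right
      simpa [hx] using hl
    · left
      simpa [hx, min_eq_right (not_le.1 hx).le] using hl
  · left
    simpa [h] using hl

theorem badSet_reset_of_empty {n : ℕ} (e : Event n) {s : State n} (h : badSet s = ∅) :
    badSet (reset e s) = ∅ := by
  cases e with
  | flip12 => rw [badSet_flip12, h]
  | flip21 => rw [badSet_flip21, h]
  | push j => rw [badSet_push, h, Finset.erase_empty]
  | gossip p =>
    refine Finset.eq_empty_of_forall_notMem fun l hl => ?_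
    simpa [h] using mem_badSet_gossip p s l hl

theorem card_badSet_reset_le {n : ℕ} (e : Event n) (s : State n) :
    (badSet (reset e s)).card ≤ (badSet s).card + 1 := by
  cases e with
  | flip12 => rw [badSet_flip12]; omega
  | flip21 => rw [badSet_flip21]; omega
  | push j => rw [badSet_push]; exact (Finset.card_erase_le).trans (Nat.le_succ _)
  | gossip p =>
    refine (Finset.card_le_card (t := insert p.1.2 (badSet s)) fun l hl => ?_).trans
      (Finset.card_insert_le _ _)
    rw [Finset.mem_insert]
    exact (mem_badSet_gossip p s l hl).symm.imp_left And.left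

/-- A concave increasing function of the number of bad nodes, which vanishes at `0`. For small `ε`
it is a Lyapunov function: a push that repairs a bad node gains at least `1 / ε` times what a
gossip packet can lose. -/
noncomputable def badness {n : ℕ} (ε : ℝ) (s : State n) : ℝ := 1 - ε ^ (badSet s).card

theorem badness_nonneg {n : ℕ} {ε : ℝ} (h0 : 0 ≤ ε) (h1 : ε ≤ 1) (s : State n) :
    0 ≤ badness ε s := sub_nonneg.2 (pow_le_one₀ h0 h1)

theorem badness_le_one {n : ℕ} {ε : ℝ} (h0 : 0 ≤ ε) (s : State n) : badness ε s ≤ 1 :=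
  sub_le_self _ (pow_nonneg h0 _)

/-- As soon as one node `j₀` is bad, the push to `j₀` lowers the badness, and each other transition
adds at most one bad node; the resulting drift is bounded away from zero uniformly in the state. -/
theorem drift_badness_le (P : Rates) {n : ℕ} (hn : 1 ≤ n) {ε : ℝ} (h0 : 0 < ε) (h1 : ε < 1)
    (hε : clockRate P n * ε ≤ P.lamS / n / 2) (s : State n) :
    drift P (badness ε) s ≤ -(ε ^ n * (1 - ε) * (P.lamS / n / 2)) * badness ε s := by
  classical
  have hμ : 0 < P.lamS / n := div_pos P.lamS_pos (by exact_mod_cast hn)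
  rcases (badSet s).eq_empty_or_nonempty with hb | ⟨j₀, hj₀⟩
  · have h : ∀ e : Event n, badness ε (reset e s) = 0 := fun e => by
      simp [badness, badSet_reset_of_empty e hb]
    have h' : badness ε s = 0 := by simp [badness, hb]
    simp [drift, h, h']
  obtain ⟨b, hb⟩ : ∃ b, (badSet s).card = b + 1 :=
    Nat.exists_eq_succ_of_ne_zero (Finset.card_pos.2 ⟨j₀, hj₀⟩).ne'
  have hbn : b ≤ n := by
    have := Finset.card_le_univ (badSet s)
    simp only [Fintype.card_fin] at this
    omega
  have hgain : 0 ≤ ε ^ (b + 1) - ε ^ (b + 2) :=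
    sub_nonneg.2 (pow_le_pow_of_le_one h0.le h1.le (by omega))
  have hterm : ∀ e : Event n, rate P e s.Q * (badness ε (reset e s) - badness ε s) ≤
      rate P e s.Q * (ε ^ (b + 1) - ε ^ (b + 2)) +
        if e = .push j₀ then P.lamS / n * (ε ^ (b + 1) - ε ^ b) else 0 := by
    intro e
    split_ifs with he
    · subst he
      have h2 : (badSet (reset (.push j₀) s)).card = b := by
        rw [badSet_push, Finset.card_erase_of_mem hj₀, hb]; rfl
      simp only [badness, h2, hb, rate]
      have := mul_nonneg hμ.le hgain
      linarith
    · rw [add_zero]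
      refine mul_le_mul_of_nonneg_left ?_ (rate_nonneg P e _)
      have h2 := card_badSet_reset_le e s
      rw [hb] at h2
      have := pow_le_pow_of_le_one h0.le h1.le h2
      simp only [badness, hb]
      linarith
  have hsum := Finset.sum_le_sum fun e (_ : e ∈ Finset.univ) => hterm e
  rw [Finset.sum_add_distrib, ← Finset.sum_mul, Finset.sum_ite_eq' Finset.univ,
    if_pos (Finset.mem_univ _)] at hsum
  have hΛ := mul_le_mul_of_nonneg_right (sum_rate_le_clockRate P n s.Q) hgain
  have hpow : ε ^ n ≤ ε ^ b := pow_le_pow_of_le_one h0.le h1.le hbn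
  have hpos : 0 < ε ^ b * (1 - ε) := mul_pos (pow_pos h0 _) (by linarith)
  calc drift P (badness ε) s
      ≤ clockRate P n * (ε ^ (b + 1) - ε ^ (b + 2)) + P.lamS / n * (ε ^ (b + 1) - ε ^ b) :=
        hsum.trans (by linarith)
    _ = ε ^ b * (1 - ε) * (clockRate P n * ε - P.lamS / n) := by ring
    _ ≤ ε ^ b * (1 - ε) * (-(P.lamS / n / 2)) :=
        mul_le_mul_of_nonneg_left (by linarith) hpos.le
    _ ≤ -(ε ^ n * (1 - ε) * (P.lamS / n / 2)) := by
        have := mul_le_mul_of_nonneg_right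
          (mul_le_mul_of_nonneg_right hpow (show 0 ≤ 1 - ε by linarith))
          (show 0 ≤ P.lamS / n / 2 by linarith)
        linarith
    _ ≤ -(ε ^ n * (1 - ε) * (P.lamS / n / 2)) * badness ε s := by
        have h3 : 0 ≤ ε ^ n * (1 - ε) * (P.lamS / n / 2) :=
          mul_nonneg (mul_nonneg (pow_nonneg h0.le _) (by linarith)) (by linarith)
        have := mul_le_mul_of_nonneg_left (badness_le_one h0.le s) h3
        linarith

theorem lamS_div_le_clockRate (P : Rates) {n : ℕ} (hn : 1 ≤ n) : P.lamS / n ≤ clockRate P n :=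
  (Finset.single_le_sum (f := fun e : Event n => rate P e 0) (fun e _ => rate_nonneg P e 0)
    (Finset.mem_univ (Event.push ⟨0, hn⟩))).trans (sum_rate_le_clockRate P n 0)

/-- The probability that some node still holds an inherited packet tends to zero. -/
theorem tendsto_mean_bad (P : Rates) {n : ℕ} (hn : 1 ≤ n) (μ₀ : PMF (State n)) :
    Tendsto (mean P μ₀ fun s => if badSet s = ∅ then 0 else 1) atTop (𝓝 0) := by
  have hΛ := clockRate_pos P n
  have hμ : 0 < P.lamS / n := div_pos P.lamS_pos (by exact_mod_cast hn)
  have hμΛ := lamS_div_le_clockRate P hn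
  -- with this `ε`, the gain from one repairing push is twice the possible loss at all transitions
  obtain ⟨ε, hε⟩ : ∃ ε, ε = P.lamS / n / 2 / clockRate P n := ⟨_, rfl⟩
  have hεΛ : clockRate P n * ε = P.lamS / n / 2 := by rw [hε]; field_simp
  have h0 : 0 < ε := hε ▸ by positivity
  have h1 : ε < 1 := by
    rw [hε, div_lt_one hΛ]; linarith
  have hB : ∀ s : State n, |badness ε s| ≤ 1 := fun s => by
    rw [abs_of_nonneg (badness_nonneg h0.le h1.le s)]
    exact badness_le_one h0.le s
  obtain ⟨c, hc⟩ : ∃ c, c = ε ^ n * (1 - ε) * (P.lamS / n / 2) := ⟨_, rfl⟩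
  have hc0 : 0 < c := hc ▸ mul_pos (mul_pos (pow_pos h0 _) (by linarith)) (by linarith)
  have hc1 : c ≤ clockRate P n := by
    have h2 : ε ^ n * (1 - ε) ≤ 1 :=
      mul_le_one₀ (pow_le_one₀ h0.le h1.le) (by linarith) (by linarith)
    have := mul_le_mul_of_nonneg_right h2 (show 0 ≤ P.lamS / n / 2 by linarith)
    linarith
  have hdecay : Tendsto (mean P μ₀ (badness ε)) atTop (𝓝 0) := by
    refine tendsto_zero_of_le_mul_add (a := 1 - c / clockRate P n) (d := fun _ => 0)
      (sub_nonneg.2 ((div_le_one hΛ).2 hc1)) (by linarith [div_pos hc0 hΛ])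
      (fun k => integral_nonneg fun s => badness_nonneg h0.le h1.le s)
      tendsto_const_nhds fun k => ?_
    rw [mean_succ P μ₀ hB, add_zero]
    have h2 : mean P μ₀ (drift P (badness ε)) k ≤ -c * mean P μ₀ (badness ε) k := by
      rw [← mean_const_mul]
      refine mean_mono P μ₀ (abs_drift_le P hB) (N := c) (fun s => ?_)
        (fun s => hc ▸ drift_badness_le P hn h0 h1 hεΛ.le s) k
      rw [abs_mul, abs_neg, abs_of_pos hc0]
      exact mul_le_of_le_one_right hc0.le (hB s)
    have := div_le_div_of_nonneg_right h2 hΛ.le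
    calc _ ≤ mean P μ₀ (badness ε) k + -c * mean P μ₀ (badness ε) k / clockRate P n := by linarith
      _ = _ := by ring
  have hup := hdecay.const_mul (1 - ε)⁻¹
  rw [mul_zero] at hup
  have hI : ∀ s : State n, (0 : ℝ) ≤ if badSet s = ∅ then 0 else 1 := fun s => by
    split_ifs <;> norm_num
  refine squeeze_zero (fun k => integral_nonneg hI) (fun k => ?_) hup
  rw [← mean_const_mul]
  have h2 : 0 < (1 - ε)⁻¹ := inv_pos.2 (by linarith)
  refine mean_mono P μ₀ (M := 1) (N := (1 - ε)⁻¹) (fun s => ?_) (fun s => ?_) (fun s => ?_) k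
  · split_ifs <;> simp
  · rw [abs_mul, abs_of_pos h2]
    exact mul_le_of_le_one_right h2.le (hB s)
  · split_ifs with hb
    · exact mul_nonneg h2.le (badness_nonneg h0.le h1.le s)
    · have h3 : ε ^ (badSet s).card ≤ ε := by
        simpa using pow_le_pow_of_le_one h0.le h1.le
          (Finset.card_pos.2 (Finset.nonempty_iff_ne_empty.2 hb))
      rw [inv_mul_eq_div, le_div_iff₀ (by linarith), badness]
      linarith

/-! ### The parity of the minimal version age -/

/-- Indicator that the minimal version age in `A` is even and that the source is in mode `m`. -/
noncomputable def tag {n : ℕ} (A : Finset (Fin n)) (hA : A.Nonempty) (m : Fin 2) (s : State n) :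
    ℝ :=
  (if Even (A.inf' hA s.X) then 1 else 0) * (if s.Q = m then 1 else 0)

/-- Indicator that the source is in mode `m`. -/
noncomputable def inMode {n : ℕ} (m : Fin 2) (s : State n) : ℝ := if s.Q = m then 1 else 0

/-- The rate at which the source leaves mode `m`. -/
noncomputable def outRate (P : Rates) (m : Fin 2) : ℝ := if m = 0 then P.q12 else P.q21

theorem abs_inMode_le {n : ℕ} (m : Fin 2) (s : State n) : |inMode m s| ≤ 1 := by
  unfold inMode; split_ifs <;> simp

theorem abs_tag_le {n : ℕ} (A : Finset (Fin n)) (hA : A.Nonempty) (m : Fin 2) (s : State n) :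
    |tag A hA m s| ≤ 1 := by
  unfold tag; split_ifs <;> simp

theorem abs_freshAcc_mul_le {n : ℕ} (A : Finset (Fin n)) (hA : A.Nonempty) (m : Fin 2)
    (s : State n) : |freshAcc A hA s * (if s.Q = m then 1 else 0)| ≤ 1 := by
  unfold freshAcc; split_ifs <;> simp

theorem freshAcc_eq_of_badSet_eq_empty {n : ℕ} (A : Finset (Fin n)) (hA : A.Nonempty)
    {s : State n} (h : badSet s = ∅) :
    freshAcc A hA s = if Even (A.inf' hA s.X) then 1 else 0 := by
  have hX : s.X (Function.argminOn s.X (A : Set (Fin n)) (Finset.coe_nonempty.2 hA)) =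
      A.inf' hA s.X :=
    le_antisymm (Finset.le_inf' _ _ fun l hl => Function.argminOn_le s.X (A : Set (Fin n)) hl)
      (Finset.inf'_le _ (Function.argminOn_mem s.X (A : Set (Fin n)) _))
  have hC : ∀ l, s.C l = decide (Even (s.X l)) := fun l => by
    by_contra hl
    have := mem_badSet.2 hl
    simp [h] at this
  rw [freshAcc, hC, hX]
  simp

theorem abs_freshAcc_sub_tag_le {n : ℕ} (A : Finset (Fin n)) (hA : A.Nonempty) (m : Fin 2)
    (s : State n) : |freshAcc A hA s * (if s.Q = m then 1 else 0) - tag A hA m s| ≤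
      if badSet s = ∅ then 0 else 1 := by
  by_cases h : badSet s = ∅
  · rw [if_pos h, freshAcc_eq_of_badSet_eq_empty A hA h, ← tag, sub_self, abs_zero]
  · rw [if_neg h]
    unfold freshAcc tag
    split_ifs <;> simp

/-! ### Transitions acting on the minimal age -/

theorem inf'_add_one {n : ℕ} (A : Finset (Fin n)) (hA : A.Nonempty) (X : Fin n → ℕ) :
    (A.inf' hA fun l => X l + 1) = A.inf' hA X + 1 :=
  le_antisymm
    (by
      obtain ⟨l, hl, h⟩ := A.exists_mem_eq_inf' hA X
      rw [h]
      exact Finset.inf'_le (fun l => X l + 1) hl)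
    (Finset.le_inf' _ _ fun l hl => Nat.add_le_add_right (Finset.inf'_le X hl) 1)

theorem inf'_update_of_notMem {n : ℕ} (A : Finset (Fin n)) (hA : A.Nonempty) (X : Fin n → ℕ)
    {j : Fin n} (hj : j ∉ A) (x : ℕ) : A.inf' hA (Function.update X j x) = A.inf' hA X :=
  Finset.inf'_congr hA rfl fun l hl =>
    Function.update_of_ne (fun h => hj (by rwa [← h])) _ _

theorem inf'_update_zero {n : ℕ} (A : Finset (Fin n)) (hA : A.Nonempty) (X : Fin n → ℕ)
    {j : Fin n} (hj : j ∈ A) : A.inf' hA (Function.update X j 0) = 0 :=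
  Nat.le_zero.1 (by simpa using Finset.inf'_le (Function.update X j 0) hj)

theorem inf'_update_min {n : ℕ} (A : Finset (Fin n)) (hA : A.Nonempty) (X : Fin n → ℕ)
    {i j : Fin n} (hj : j ∈ A) :
    A.inf' hA (Function.update X j (min (X i) (X j))) =
      (insert i A).inf' (Finset.insert_nonempty i A) X := by
  refine eq_of_forall_le_iff fun c => ?_
  simp only [Finset.le_inf'_iff, Finset.forall_mem_insert]
  constructor
  · intro h
    have h1 := h j hj
    rw [Function.update_self] at h1
    refine ⟨h1.trans (min_le_left _ _), fun l hl => ?_⟩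
    by_cases hlj : l = j
    · exact hlj ▸ h1.trans (min_le_right _ _)
    · simpa [hlj] using h l hl
  · rintro ⟨h1, h2⟩ l hl
    by_cases hlj : l = j
    · subst hlj
      simpa using ⟨h1, h2 l hl⟩
    · simpa [hlj] using h2 l hl

theorem tag_push {n : ℕ} (A : Finset (Fin n)) (hA : A.Nonempty) (m : Fin 2) (j : Fin n)
    (s : State n) :
    tag A hA m (reset (.push j) s) = if j ∈ A then inMode m s else tag A hA m s := by
  change (if Even (A.inf' hA (Function.update s.X j 0)) then (1 : ℝ) else 0) *
    (if s.Q = m then 1 else 0) = _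
  by_cases hj : j ∈ A
  · rw [if_pos hj, inf'_update_zero A hA s.X hj, if_pos Even.zero, one_mul, inMode]
  · rw [if_neg hj, inf'_update_of_notMem A hA s.X hj, tag]

/-- A packet sent from `i` into `A` makes the minimal age of `A` that of `insert i A`. -/
theorem tag_gossip {n : ℕ} (A : Finset (Fin n)) (hA : A.Nonempty) (m : Fin 2)
    (p : {p : Fin n × Fin n // p.1 ≠ p.2}) (s : State n) :
    tag A hA m (reset (.gossip p) s) - tag A hA m s =
      if p.1.1 ∉ A ∧ p.1.2 ∈ A then
        tag (insert p.1.1 A) (Finset.insert_nonempty _ _) m s - tag A hA m s else 0 := by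
  by_cases hj : p.1.2 ∈ A
  · by_cases hi : p.1.1 ∈ A
    · simp [tag, reset, inf'_update_min A hA s.X hj, hi, Finset.insert_eq_of_mem hi]
    · simp [tag, reset, inf'_update_min A hA s.X hj, hi, hj]
  · simp [tag, reset, inf'_update_of_notMem A hA s.X hj, hj]

/-- Only packets from outside `A` into `A` contribute; the constraint `p.1 ≠ p.2` is then
automatic. -/
theorem sum_crossing {n : ℕ} (A : Finset (Fin n)) (g : Fin n → Fin n → ℝ) :
    ∑ p : {p : Fin n × Fin n // p.1 ≠ p.2},
      (if p.1.1 ∉ A ∧ p.1.2 ∈ A then g p.1.1 p.1.2 else 0) = ∑ i ∈ Aᶜ, ∑ j ∈ A, g i j := by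
  rw [← Finset.sum_product', ← Finset.sum_filter]
  refine Finset.sum_nbij (fun p => p.1) (fun p hp => ?_) (fun p _ q _ h => Subtype.ext h)
    (fun p hp => ?_) (fun p _ => rfl)
  · simpa using hp
  · simp only [Finset.coe_product, Set.mem_prod, Finset.mem_coe, Finset.mem_compl] at hp
    exact ⟨⟨p, fun h => hp.1 (h ▸ hp.2)⟩, by simpa using hp, rfl⟩

theorem drift_inMode (P : Rates) {n : ℕ} (m : Fin 2) (s : State n) :
    drift P (inMode m) s =
      -outRate P m * inMode m s + outRate P (1 - m) * inMode (1 - m) s := by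
  rw [drift, sum_event]
  obtain ⟨Q, C, X⟩ := s
  fin_cases m <;> fin_cases Q <;> simp [inMode, reset, rate, outRate]

/-- The generator on `tag A`: a source flip exchanges the two parities, a push into `A` makes the
minimal age `0`, and gossip into `A` enlarges `A` by the sender. -/
theorem drift_tag (P : Rates) {n : ℕ} (A : Finset (Fin n)) (hA : A.Nonempty) (m : Fin 2)
    (s : State n) :
    drift P (tag A hA m) s =
      -outRate P m * tag A hA m s +
        outRate P (1 - m) * (inMode (1 - m) s - tag A hA (1 - m) s) +
        pushRate P n A.card * (inMode m s - tag A hA m s) +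
        P.lam / ((n : ℝ) - 1) * A.card *
          ∑ i ∈ Aᶜ, (tag (insert i A) (Finset.insert_nonempty _ _) m s - tag A hA m s) := by
  rw [drift, sum_event]
  congr 1
  · congr 1
    · obtain ⟨Q, C, X⟩ := s
      simp only [tag, reset, rate, inMode, outRate, inf'_add_one, Nat.even_add_one]
      by_cases h : Even (A.inf' hA X) <;> fin_cases m <;> fin_cases Q <;> simp [h]
    · have h : ∀ j, rate P (.push j) s.Q * (tag A hA m (reset (.push j) s) - tag A hA m s) =
          if j ∈ A then P.lamS / n * (inMode m s - tag A hA m s) else 0 := fun j => by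
        rw [tag_push]
        split_ifs <;> simp [rate]
      simp only [h, Finset.sum_ite_mem, Finset.univ_inter, Finset.sum_const, nsmul_eq_mul,
        pushRate]
      ring
  · simp only [rate, tag_gossip]
    rw [← Finset.mul_sum, sum_crossing A fun i _ =>
      tag (insert i A) (Finset.insert_nonempty _ _) m s - tag A hA m s]
    simp only [Finset.sum_const, nsmul_eq_mul]
    rw [← Finset.mul_sum, mul_assoc]

theorem card_mul_compl (P : Rates) {n : ℕ} (A : Finset (Fin n)) :
    P.lam / ((n : ℝ) - 1) * A.card * (Aᶜ.card : ℝ) = gossipRate P n A.card := by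
  have h := A.card_le_univ
  rw [Fintype.card_fin] at h
  rw [Finset.card_compl, Fintype.card_fin, Nat.cast_sub h, gossipRate]
  ring

/-- The clock is fast enough for the Euler step of each recursion to be a contraction. -/
theorem rates_le_clockRate (P : Rates) {n : ℕ} (A : Finset (Fin n)) :
    P.q12 + P.q21 + (pushRate P n A.card + gossipRate P n A.card) ≤ clockRate P n := by
  have hpush : pushRate P n A.card ≤ ∑ _j : Fin n, P.lamS / n := by
    have h := A.card_le_univ
    rw [Fintype.card_fin] at h
    have h' : (A.card : ℝ) ≤ n := by exact_mod_cast h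
    have := mul_le_mul_of_nonneg_right h' (div_nonneg P.lamS_pos.le (Nat.cast_nonneg n))
    simp only [Finset.sum_const, Finset.card_univ, Fintype.card_fin, nsmul_eq_mul, pushRate]
    rwa [mul_div_assoc]
  have hgossip : gossipRate P n A.card ≤
      ∑ _p : {p : Fin n × Fin n // p.1 ≠ p.2}, P.lam / ((n : ℝ) - 1) := by
    have h := sum_crossing A fun _ _ => P.lam / ((n : ℝ) - 1)
    simp only [Finset.sum_const, nsmul_eq_mul] at h
    rw [← card_mul_compl, show P.lam / ((n : ℝ) - 1) * A.card * (Aᶜ.card : ℝ) =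
      Aᶜ.card * (A.card * (P.lam / ((n : ℝ) - 1))) by ring, ← h]
    refine Finset.sum_le_sum fun p _ => ?_
    split_ifs
    · exact le_rfl
    · exact rate_nonneg P (Event.gossip p) 0
  have hp0 : (0 : ℝ) ≤ ∑ _j : Fin n, P.lamS / n :=
    Finset.sum_nonneg fun j _ => rate_nonneg P (Event.push j) 0
  have hg0 : 0 ≤ ∑ _p : {p : Fin n × Fin n // p.1 ≠ p.2}, P.lam / ((n : ℝ) - 1) :=
    Finset.sum_nonneg fun p _ => rate_nonneg P (Event.gossip p) 0
  rw [clockRate, sum_event]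
  simp only [Fin.sum_univ_two, rate, Finset.sum_add_distrib]
  simp only [if_true, if_false, zero_ne_one, one_ne_zero]
  linarith

/-! ### Recursions for the moments -/

/-- The source law converges to its stationary law: since the two mode probabilities sum to `1`,
each satisfies a scalar recursion with contraction rate `q12 + q21`. -/
theorem tendsto_mean_inMode (P : Rates) {n : ℕ} (μ₀ : PMF (State n)) (m : Fin 2) :
    Tendsto (mean P μ₀ (inMode m)) atTop (𝓝 (srcStat P m)) := by
  have hΛ := clockRate_pos P n
  have h1 := P.q12_pos
  have h2 := P.q21_pos
  have hq : P.q12 + P.q21 ≤ clockRate P n := by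
    have := rates_le_clockRate P (∅ : Finset (Fin n))
    simpa [pushRate, gossipRate] using this
  have hsum : ∀ k, mean P μ₀ (inMode (1 - m)) k = 1 - mean P μ₀ (inMode m) k := fun k => by
    rw [eq_sub_iff_add_eq, ← mean_add P μ₀ (abs_inMode_le _) (abs_inMode_le _)]
    have : (fun s : State n => inMode (1 - m) s + inMode m s) = fun _ => 1 := by
      funext s
      obtain ⟨Q, C, X⟩ := s
      fin_cases m <;> fin_cases Q <;> simp [inMode]
    rw [this]
    simp [mean]
  have hdrift : ∀ k, mean P μ₀ (drift P (inMode m)) k =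
      -outRate P m * mean P μ₀ (inMode m) k +
        outRate P (1 - m) * (1 - mean P μ₀ (inMode m) k) := fun k => by
    rw [← hsum, ← mean_const_mul, ← mean_const_mul,
      ← mean_add P μ₀ (M := |outRate P m|) (N := |outRate P (1 - m)|)]
    · exact congrArg (fun ψ => mean P μ₀ ψ k) (funext fun s => drift_inMode P m s)
    · intro s
      rw [abs_mul, abs_neg]
      exact mul_le_of_le_one_right (abs_nonneg _) (abs_inMode_le m s)
    · intro s
      rw [abs_mul]
      exact mul_le_of_le_one_right (abs_nonneg _) (abs_inMode_le _ s)
  have hstat : outRate P m * srcStat P m = outRate P (1 - m) * (1 - srcStat P m) := by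
    fin_cases m <;> simp [outRate, srcStat] <;> field_simp <;> ring
  have hout : outRate P m + outRate P (1 - m) = P.q12 + P.q21 := by
    fin_cases m <;> simp [outRate, add_comm]
  rw [← tendsto_sub_nhds_zero_iff]
  refine tendsto_zero_of_eq_mul_add (a := 1 - (P.q12 + P.q21) / clockRate P n) (d := fun _ => 0)
    (sub_nonneg.2 ((div_le_one hΛ).2 hq))
    (by linarith [div_pos (add_pos h1 h2) hΛ]) tendsto_const_nhds fun k => ?_
  rw [mean_succ P μ₀ (abs_inMode_le m), hdrift, ← hout]
  field_simp
  linarith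

theorem mean_drift_tag (P : Rates) {n : ℕ} (μ₀ : PMF (State n)) (A : Finset (Fin n))
    (hA : A.Nonempty) (m : Fin 2) (k : ℕ) :
    mean P μ₀ (drift P (tag A hA m)) k =
      -outRate P m * mean P μ₀ (tag A hA m) k +
        outRate P (1 - m) *
          (mean P μ₀ (inMode (1 - m)) k - mean P μ₀ (tag A hA (1 - m)) k) +
        pushRate P n A.card * (mean P μ₀ (inMode m) k - mean P μ₀ (tag A hA m) k) +
        P.lam / ((n : ℝ) - 1) * A.card *
          ∑ i ∈ Aᶜ, (mean P μ₀ (tag (insert i A) (Finset.insert_nonempty _ _) m) k -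
            mean P μ₀ (tag A hA m) k) := by
  have hT : ∀ B hB m', Integrable (tag B hB m') (jumpChain P μ₀ k).toMeasure := fun B hB m' =>
    integrable_toMeasure_of_abs_le _ (abs_tag_le B hB m')
  have hI : ∀ m', Integrable (inMode m') (jumpChain P μ₀ k).toMeasure := fun m' =>
    integrable_toMeasure_of_abs_le _ (abs_inMode_le m')
  have hIT : ∀ m', Integrable (fun s => inMode m' s - tag A hA m' s)
      (jumpChain P μ₀ k).toMeasure := fun m' => (hI m').sub (hT A hA m')
  have h1 := (hT A hA m).const_mul (-outRate P m)
  have h2 := (hIT (1 - m)).const_mul (outRate P (1 - m))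
  have h3 := (hIT m).const_mul (pushRate P n A.card)
  have h12 : Integrable (fun s => -outRate P m * tag A hA m s +
      outRate P (1 - m) * (inMode (1 - m) s - tag A hA (1 - m) s))
      (jumpChain P μ₀ k).toMeasure := h1.add h2
  have h123 : Integrable (fun s => -outRate P m * tag A hA m s +
      outRate P (1 - m) * (inMode (1 - m) s - tag A hA (1 - m) s) +
      pushRate P n A.card * (inMode m s - tag A hA m s))
      (jumpChain P μ₀ k).toMeasure := h12.add h3
  have h4 : ∀ i ∈ Aᶜ, Integrable (fun s => tag (insert i A) (Finset.insert_nonempty i A) m s -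
      tag A hA m s) (jumpChain P μ₀ k).toMeasure := fun i _ => (hT _ _ m).sub (hT A hA m)
  have h5 := (integrable_finsetSum _ h4).const_mul (P.lam / ((n : ℝ) - 1) * A.card)
  simp only [mean]
  rw [integral_congr_ae (ae_of_all _ (drift_tag P A hA m)), integral_add h123 h5,
    integral_add h12 h3, integral_add h1 h2, integral_const_mul, integral_const_mul,
    integral_const_mul, integral_const_mul, integral_finsetSum _ h4,
    integral_sub (hI _) (hT _ _ _), integral_sub (hI _) (hT _ _ _)]
  congr 2
  exact Finset.sum_congr rfl fun i _ => integral_sub (hT _ _ _) (hT _ _ _)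

/-! ### The equations of the limit -/

theorem pushRate_pos (P : Rates) {n k : ℕ} (hn : 1 ≤ n) (hk : 1 ≤ k) : 0 < pushRate P n k := by
  have := P.lamS_pos
  have : (0 : ℝ) < n := by exact_mod_cast hn
  have : (0 : ℝ) < k := by exact_mod_cast hk
  unfold pushRate
  positivity

theorem gossipRate_nonneg (P : Rates) {n k : ℕ} (hn : 1 ≤ n) (hk : k ≤ n) :
    0 ≤ gossipRate P n k := by
  have h1 : (1 : ℝ) ≤ n := by exact_mod_cast hn
  have h2 : (k : ℝ) ≤ n := by exact_mod_cast hk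
  exact div_nonneg (mul_nonneg (mul_nonneg (Nat.cast_nonneg k) (by linarith)) P.lam_nonneg)
    (by linarith)

theorem mulVec_W_apply (P : Rates) (n k : ℕ) (x : Fin 2 → ℝ) (m : Fin 2) :
    Matrix.mulVec (W P n k) x m =
      (outRate P m + (pushRate P n k + gossipRate P n k)) * x m +
        outRate P (1 - m) * x (1 - m) := by
  fin_cases m
  · simp [W, outRate, Matrix.mulVec, dotProduct, Fin.sum_univ_two, add_assoc]
  · simp only [W, outRate, Matrix.mulVec, dotProduct, Fin.sum_univ_two]
    simp
    ring

theorem v_add_mulVec_V_apply (P : Rates) (n k : ℕ) (x : Fin 2 → ℝ) (m : Fin 2) :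
    (v P n k + Matrix.mulVec (V P n k) x) m =
      outRate P (1 - m) * srcStat P (1 - m) + pushRate P n k * srcStat P m +
        gossipRate P n k * x m := by
  fin_cases m <;> simp [v, V, outRate, Matrix.smul_mulVec]

theorem isUnit_W (P : Rates) {n k : ℕ} (hn : 1 ≤ n) (hk : 1 ≤ k) (hkn : k ≤ n) :
    IsUnit (W P n k) := by
  have h1 := pushRate_pos P hn hk
  have h2 := gossipRate_nonneg P hn hkn
  have h3 := P.q12_pos
  have h4 := P.q21_pos
  rw [Matrix.isUnit_iff_isUnit_det, isUnit_iff_ne_zero, W, Matrix.det_fin_two_of]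
  have : 0 < (pushRate P n k + gossipRate P n k) *
      (P.q12 + P.q21 + (pushRate P n k + gossipRate P n k)) := by positivity
  refine ne_of_gt (lt_of_lt_of_eq this ?_)
  ring

/-- The limit moments, indexed by the number `r` of nodes outside the set. -/
noncomputable def limitFromTop (P : Rates) (n : ℕ) : ℕ → Fin 2 → ℝ
  | 0 => (1 / ((P.q12 + P.q21) * (P.lamS + P.q12 + P.q21))) •
      ![P.q21 * (P.lamS + P.q21), P.q12 * (P.lamS + P.q12)]
  | r + 1 => Matrix.mulVec (W P n (n - (r + 1)))⁻¹
      (v P n (n - (r + 1)) + Matrix.mulVec (V P n (n - (r + 1))) (limitFromTop P n r))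

theorem limitFromTop_zero_equations (P : Rates) (n : ℕ) :
    P.q21 * (srcStat P 1 - limitFromTop P n 0 1) - P.q12 * limitFromTop P n 0 0 +
        P.lamS * (srcStat P 0 - limitFromTop P n 0 0) = 0 ∧
      P.q12 * (srcStat P 0 - limitFromTop P n 0 0) - P.q21 * limitFromTop P n 0 1 +
        P.lamS * (srcStat P 1 - limitFromTop P n 0 1) = 0 := by
  have h1 := P.q12_pos
  have h2 := P.q21_pos
  have h3 := P.lamS_pos
  constructor <;> simp [limitFromTop, srcStat] <;> field_simp <;> ring

theorem mulVec_W_limitFromTop_succ (P : Rates) {n r : ℕ} (hr : r + 1 < n) :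
    Matrix.mulVec (W P n (n - (r + 1))) (limitFromTop P n (r + 1)) =
      v P n (n - (r + 1)) + Matrix.mulVec (V P n (n - (r + 1))) (limitFromTop P n r) := by
  rw [limitFromTop, Matrix.mulVec_mulVec, Matrix.mul_nonsing_inv, Matrix.one_mulVec]
  exact (Matrix.isUnit_iff_isUnit_det _).1 (isUnit_W P (by omega) (by omega) (by omega))

/-- The stationary equation also holds for the full set, where the gossip rate from outside
vanishes and `g` is arbitrary. -/
theorem mulVec_W_limitFromTop_zero (P : Rates) {n : ℕ} (hn : 1 ≤ n) (g : Fin 2 → ℝ) :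
    Matrix.mulVec (W P n n) (limitFromTop P n 0) = v P n n + Matrix.mulVec (V P n n) g := by
  obtain ⟨h1, h2⟩ := limitFromTop_zero_equations P n
  have hg : gossipRate P n n = 0 := by simp [gossipRate]
  have hp : pushRate P n n = P.lamS := by
    have : (n : ℝ) ≠ 0 := by exact_mod_cast (by omega : n ≠ 0)
    rw [pushRate]; field_simp
  funext m
  rw [mulVec_W_apply, v_add_mulVec_V_apply, hg, hp]
  fin_cases m
  · simp only [outRate, Fin.zero_eta, sub_zero]
    norm_num
    linarith
  · simp only [outRate, Fin.mk_one, sub_self]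
    norm_num
    linarith

/-! ### Downward induction on the size of the set -/

/-- One step of the downward induction: if the moments of all sets `insert i A`, `i ∉ A`, converge
to `g`, then those of `A` converge to the solution `f` of the stationary equation. -/
theorem tendsto_mean_tag_of_insert (P : Rates) {n : ℕ} (hn : 1 ≤ n) (μ₀ : PMF (State n))
    (A : Finset (Fin n)) (hA : A.Nonempty) {f g : Fin 2 → ℝ}
    (hf : Matrix.mulVec (W P n A.card) f = v P n A.card + Matrix.mulVec (V P n A.card) g)
    (hg : ∀ i ∈ Aᶜ, ∀ m, Tendsto (mean P μ₀ (tag (insert i A) (Finset.insert_nonempty _ _) m))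
      atTop (𝓝 (g m))) (m : Fin 2) :
    Tendsto (mean P μ₀ (tag A hA m)) atTop (𝓝 (f m)) := by
  -- the inhomogeneity of the recursion for the error `mean (tag A) - f`
  obtain ⟨d, hd⟩ : ∃ d : Fin 2 → ℕ → ℝ, ∀ m k, d m k =
      outRate P (1 - m) * (mean P μ₀ (inMode (1 - m)) k - srcStat P (1 - m)) +
        pushRate P n A.card * (mean P μ₀ (inMode m) k - srcStat P m) +
        P.lam / ((n : ℝ) - 1) * A.card *
          ∑ i ∈ Aᶜ, (mean P μ₀ (tag (insert i A) (Finset.insert_nonempty _ _) m) k - g m) :=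
    ⟨_, fun _ _ => rfl⟩
  have hd0 : ∀ m, Tendsto (d m) atTop (𝓝 0) := fun m => by
    have hin : ∀ m, Tendsto (fun k => mean P μ₀ (inMode m) k - srcStat P m) atTop (𝓝 0) :=
      fun m => tendsto_sub_nhds_zero_iff.2 (tendsto_mean_inMode P μ₀ m)
    have hs := tendsto_finsetSum Aᶜ fun i hi => tendsto_sub_nhds_zero_iff.2 (hg i hi m)
    rw [Finset.sum_const_zero] at hs
    have := (((hin (1 - m)).const_mul (outRate P (1 - m))).add
      ((hin m).const_mul (pushRate P n A.card))).add
      (hs.const_mul (P.lam / ((n : ℝ) - 1) * A.card))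
    simp only [mul_zero, add_zero] at this
    exact this.congr fun k => (hd m k).symm
  have hγ : 0 < pushRate P n A.card + gossipRate P n A.card :=
    add_pos_of_pos_of_nonneg (pushRate_pos P hn hA.card_pos)
      (gossipRate_nonneg P hn (by simpa using A.card_le_univ))
  have hrec : ∀ m k, mean P μ₀ (tag A hA m) (k + 1) - f m = mean P μ₀ (tag A hA m) k - f m +
      (-(outRate P m + (pushRate P n A.card + gossipRate P n A.card)) *
        (mean P μ₀ (tag A hA m) k - f m) -
        outRate P (1 - m) * (mean P μ₀ (tag A hA (1 - m)) k - f (1 - m)) + d m k) /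
        clockRate P n := fun m k => by
    have h := congrFun hf m
    rw [mulVec_W_apply, v_add_mulVec_V_apply] at h
    rw [mean_succ P μ₀ (abs_tag_le A hA m), mean_drift_tag, hd, add_sub_right_comm]
    congr 2
    simp only [Finset.sum_sub_distrib, Finset.sum_const, nsmul_eq_mul]
    have hc := card_mul_compl P A
    linear_combination -h +
      (g m - mean P μ₀ (tag A hA m) k) * hc
  have hpair := tendsto_zero_of_pair_recursion (x := fun k => mean P μ₀ (tag A hA 0) k - f 0)
    (y := fun k => mean P μ₀ (tag A hA 1) k - f 1) P.q12_pos P.q21_pos hγ (rates_le_clockRate P A)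
    (hd0 0) (hd0 1) (fun k => by simpa [outRate] using hrec 0 k)
    (fun k => by simpa [outRate] using hrec 1 k)
  rw [← tendsto_sub_nhds_zero_iff]
  fin_cases m
  · exact hpair.1
  · exact hpair.2

theorem tendsto_mean_tag (P : Rates) {n : ℕ} (hn : 1 ≤ n) (μ₀ : PMF (State n)) (r : ℕ) :
    ∀ (A : Finset (Fin n)) (hA : A.Nonempty), A.card + r = n → ∀ m,
      Tendsto (mean P μ₀ (tag A hA m)) atTop (𝓝 (limitFromTop P n r m)) := by
  induction r with
  | zero =>
    intro A hA hc m
    rw [add_zero] at hc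
    refine tendsto_mean_tag_of_insert P hn μ₀ A hA (g := 0) ?_ (fun i hi => ?_) m
    · rw [hc]
      exact mulVec_W_limitFromTop_zero P hn 0
    · rw [(Finset.card_eq_iff_eq_univ A).1 (by simpa using hc)] at hi
      simp at hi
  | succ r ih =>
    intro A hA hc m
    refine tendsto_mean_tag_of_insert P hn μ₀ A hA (g := limitFromTop P n r) ?_
      (fun i hi => ih _ _ ?_) m
    · have hA' := hA.card_pos
      rw [show A.card = n - (r + 1) by omega]
      exact mulVec_W_limitFromTop_succ P (by omega)
    · rw [Finset.card_insert_of_notMem (Finset.mem_compl.1 hi)]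
      omega

theorem tendsto_taggedAcc (P : Rates) {n : ℕ} (hn : 1 ≤ n) (μ₀ : PMF (State n))
    (A : Finset (Fin n)) (hA : A.Nonempty) (m : Fin 2) :
    Tendsto (fun t => taggedAcc P μ₀ A hA m t) atTop (𝓝 (limitFromTop P n (n - A.card) m)) := by
  have hcard : A.card ≤ n := by simpa using A.card_le_univ
  refine tendsto_integral_law P μ₀ (abs_freshAcc_mul_le A hA m) ?_
  have htag := tendsto_mean_tag P hn μ₀ (n - A.card) A hA (by omega) m
  -- Off the event that some node holds an inherited packet, `freshAcc` is the parity of the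
  -- minimal age, however `argminOn` breaks ties.
  have hdiff : Tendsto (fun k =>
      mean P μ₀ (fun s => freshAcc A hA s * (if s.Q = m then 1 else 0)) k -
        mean P μ₀ (tag A hA m) k) atTop (𝓝 0) := by
    refine squeeze_zero_norm (fun k => ?_) (tendsto_mean_bad P hn μ₀)
    rw [← mean_sub P μ₀ (abs_freshAcc_mul_le A hA m) (abs_tag_le A hA m), Real.norm_eq_abs]
    refine abs_integral_le_integral_abs.trans ?_
    refine mean_mono P μ₀ (M := 2) (N := 1) (fun s => ?_) (fun s => ?_)
      (abs_freshAcc_sub_tag_le A hA m) k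
    · rw [abs_abs]
      refine (abs_sub _ _).trans ?_
      linarith [abs_freshAcc_mul_le A hA m s, abs_tag_le A hA m s]
    · split_ifs <;> simp
  have := hdiff.add htag
  rw [zero_add] at this
  exact this.congr fun k => sub_add_cancel _ _

end GossipNet

open GossipNet in
theorem mainTheorem2 (P : GossipNet.Rates) (n : ℕ) (hn : 1 ≤ n) :
    ∃ f : ℕ → Fin 2 → ℝ,
      (∀ (μ₀ : PMF (State n)) (A : Finset (Fin n)) (hA : A.Nonempty) (m : Fin 2),
        Tendsto (fun t : ℝ => taggedAcc P μ₀ A hA m t) atTop (𝓝 (f A.card m))) ∧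
      (∀ k : ℕ, 1 ≤ k → k ≤ n - 1 →
        Matrix.mulVec (W P n k) (f k) = v P n k + Matrix.mulVec (V P n k) (f (k + 1)) ∧
        IsUnit (W P n k) ∧
        f k = Matrix.mulVec (W P n k)⁻¹ (v P n k + Matrix.mulVec (V P n k) (f (k + 1)))) ∧
      (P.q21 * (srcStat P 1 - f n 1) - P.q12 * f n 0 + P.lamS * (srcStat P 0 - f n 0) = 0 ∧
        P.q12 * (srcStat P 0 - f n 0) - P.q21 * f n 1 + P.lamS * (srcStat P 1 - f n 1) = 0) ∧
      f n = (1 / ((P.q12 + P.q21) * (P.lamS + P.q12 + P.q21))) •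
        ![P.q21 * (P.lamS + P.q21), P.q12 * (P.lamS + P.q12)] := by
  refine ⟨fun k => limitFromTop P n (n - k), fun μ₀ A hA m => tendsto_taggedAcc P hn μ₀ A hA m,
    fun k hk hkn => ?_, ?_, ?_⟩
  · obtain ⟨r, hr⟩ : ∃ r, n = k + (r + 1) := ⟨n - k - 1, by omega⟩
    have h1 : n - k = r + 1 := by omega
    have h2 : n - (k + 1) = r := by omega
    have h3 : n - (r + 1) = k := by omega
    have hW := mulVec_W_limitFromTop_succ P (n := n) (r := r) (by omega)
    simp only [h1, h2]
    rw [h3] at hW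
    refine ⟨hW, isUnit_W P hn hk (by omega), ?_⟩
    rw [limitFromTop, h3]
  · simp only [Nat.sub_self]
    exact limitFromTop_zero_equations P n
  · simp only [Nat.sub_self, limitFromTop]
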